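/- Let $p$ be a prime. For $n,j\ge 0$ let $\vartheta_p(j,n)$ be the number of $t\in\{0,\dots,n\}$ such that $p^j$ exactly divides $\binom nt$. Write words over the digits $\{0,\dots,p-1\}$ as $w=w_{\mu-1}\cdots w_0$, and let $(w)_p=\sum_i w_ip^i$. Let $W$ be the set of admissible words, that is, those with $\mu\ge 2$, $w_{\mu-1}\ne 0$ and $w_0\ne p-1$. For $w\in W$ let $|n|_w$ be the number of $i\ge 0$ with $n_{i+\mu-1}\cdots n_i=w_{\mu-1}\cdots w_0$, where $n=\sum_{i\ge 0}n_ip^i$ is the base-$p$ expansion of $n$, padded with zeros. Put $$\overline T_n(x)=\frac1{\vartheta_p(0,n)}\sum_{j\ge 0}\vartheta_p(j,n)x^j,\qquad \overline T_w=\overline T_{(w)_p},$$ with $\overline T_\varepsilon=\overline T_0=1$ for the empty word $\varepsilon$. For a nonempty word $w$ with nonzero leftmost digit, let $w_R$ be $w$ without its rightmost digit, let $w_L$ be $w$ without its leftmost digit and without the zeros that then lead, set $\varepsilon_L=\varepsilon_R=\varepsilon$ and $w_{LR}=(w_L)_R$, and define the rational function $$r_w(x)=\frac{\overline T_w(x)\,\overline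 T_{w_{LR}}(x)}{\overline T_{w_R}(x)\,\overline T_{w_L}(x)},$$ which is defined at $0$ with $r_w(0)=1$. Let $K$ be a field of characteristic $0$. For every $j\ge 0$ there is exactly one polynomial $P_j$ with coefficients in $K$ in the variables $X_w$ ($w\in W$) such that $$P_j\bigl((|n|_w)_{w\in W}\bigr)=\frac{\vartheta_p(j,n)}{\vartheta_p(0,n)}\qquad\text{for all } n\ge 0;$$ it has total degree $j$, and only variables $X_w$ with $w$ of length at most $j+1$ occur in it. Moreover, let $w^{(1)},\dots,w^{(\ell)}$ ($\ell\ge 0$) be pairwise distinct admissible words and $k_1,\dots,k_\ell$ positive integers, and let $c_j$ be the coefficient of the monomial $X_{w^{(1)}}^{k_1}\cdots X_{w^{(\ell)}}^{k_\ell}$ in $P_j$. Then, as formal power series, $$\sum_{j\ge 0}c_jx^j=\prod_{i=1}^{\ell}\frac1{k_i!}\bigl(\log r_{w^{(i)}}(x)\bigr)^{k_i}.$$ -/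

import Mathlib

/-- `ϑ_p(j, n)`: the number of `t ∈ {0, …, n}` such that `p ^ j` exactly divides `n.choose t`. -/
def rowCount (p j n : ℕ) : ℕ :=
  ((Finset.range (n + 1)).filter fun t => padicValNat p (n.choose t) = j).card

/-- `T_n(x) = ∑_{0 ≤ t ≤ n} x ^ ν_p(n.choose t)`. -/
noncomputable def rowPoly (K : Type*) [Field K] (p n : ℕ) : Polynomial K :=
  ∑ t ∈ Finset.range (n + 1), Polynomial.X ^ padicValNat p (n.choose t)

/-- The normalized polynomial `T_n(x) / ϑ_p(0, n)`. -/
noncomputable def normRowPoly (K : Type*) [Field K] (p n : ℕ) : Polynomial K :=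
  Polynomial.C ((rowCount p 0 n : K)⁻¹) * rowPoly K p n

/-- The normalized polynomials have constant term `1`, so they may be inverted as power series. -/
theorem normRowPoly_coeff_zero (K : Type*) [Field K] [CharZero K] (p n : ℕ) :
    (normRowPoly K p n).coeff 0 = 1 := by
  have h0 : (rowCount p 0 n : K) ≠ 0 := by
    rw [Nat.cast_ne_zero, rowCount, ← Nat.pos_iff_ne_zero, Finset.card_pos]
    exact ⟨0, by simp [em]⟩
  have h1 : (rowPoly K p n).coeff 0 = (rowCount p 0 n : K) := by
    simp [rowPoly, rowCount, Polynomial.finsetSum_coeff, Polynomial.coeff_X_pow, eq_comm,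
      Finset.sum_boole]
  rw [normRowPoly, Polynomial.coeff_C_mul, h1, inv_mul_cancel₀ h0]

/-- Words `w_{μ-1} ⋯ w_0` are lists of digits with the least significant digit first, that is
`[w_0, …, w_{μ-1}]` (the convention of `Nat.digits`). A word is admissible if it has length at
least `2`, its leftmost digit `w_{μ-1}` is not `0` and its rightmost digit `w_0` is not `p - 1`. -/
structure IsAdmissible (p : ℕ) (w : List ℕ) : Prop where
  digit_lt : ∀ d ∈ w, d < p
  two_le_length : 2 ≤ w.length
  leftmost_ne : w.getLast? ≠ some 0
  rightmost_ne : w.head? ≠ some (p - 1)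

/-- The set `W` of admissible words, which indexes the variables `X_w`. -/
abbrev AdmissibleWord (p : ℕ) : Type := {w : List ℕ // IsAdmissible p w}

/-- `|n|_w`: the number of `i ≥ 0` with `n_{i+μ-1} ⋯ n_i = w_{μ-1} ⋯ w_0`, where `n_k` is the
`k`-th base-`p` digit of `n` (so the expansion is padded with zeros). -/
noncomputable def blockCount (p : ℕ) (w : List ℕ) (n : ℕ) : ℕ :=
  Set.ncard {i : ℕ | ∀ (k : ℕ) (hk : k < w.length), n / p ^ (i + k) % p = w[k]}

/-- Left truncation `w_L`: remove the leftmost digit and then all leading zeros. -/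
def leftTrunc (w : List ℕ) : List ℕ := w.dropLast.rdropWhile (fun d => d == 0)

/-- Right truncation `w_R`: remove the rightmost digit. -/
def rightTrunc (w : List ℕ) : List ℕ := w.tail

/-- The normalized polynomial of the integer `(w)_p` represented by the word `w` in base `p`,
as a power series. -/
noncomputable def wordSeries (K : Type*) [Field K] (p : ℕ) (w : List ℕ) : PowerSeries K :=
  (normRowPoly K p (Nat.ofDigits p w) : PowerSeries K)

/-- The rational function `r_w`, as the power series at `0` that it defines. -/
noncomputable def wordRatio (K : Type*) [Field K] (p : ℕ) (w : List ℕ) : PowerSeries K :=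
  wordSeries K p w * wordSeries K p (rightTrunc (leftTrunc w)) *
    (wordSeries K p (rightTrunc w) * wordSeries K p (leftTrunc w))⁻¹

/-- The polynomial `Q` in the variables `X_w`, `w ∈ W`, takes the value `ϑ_p(j, n) / ϑ_p(0, n)` at
`X_w = |n|_w`, for every `n ≥ 0`. -/
def Represents {K : Type*} [Field K] (p j : ℕ) (Q : MvPolynomial (AdmissibleWord p) K) : Prop :=
  ∀ n : ℕ, MvPolynomial.eval (fun w : AdmissibleWord p => (blockCount p w.1 n : K)) Q =
    (rowCount p j n : K) / (rowCount p 0 n : K)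

/-! The core is the factorization of $\overline T_n$ as $\prod_w r_w^{|n|_w}$
(`normRowSeries_eq_prod`). The ratios of the windows of lengths $2,\dots,L+1$ at the low end of $n$
telescope, for large $L$, to $\overline T_n/\overline T_{\lfloor n/p\rfloor}$
(`prod_wordRatio_digitWindow`); deleting low digits one at a time then collects every position.

Only admissible words matter, and long ones only in high degree. Together with a companion,
$\overline T_n$ obeys a linear $2\times2$ recursion in the lowest digit whose determinant is a
scalar times $x$. Iterating gives `exists_wedge_eq`, hence `exists_wordRatio_sub_one_eq`: $r_w-1$ is
divisible by $x^{\mu-1}$, and it vanishes if the leftmost digit is $0$ or the rightmost is $p-1$.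

Thus $\overline T_n=\exp\bigl(\sum_w |n|_w\log r_w\bigr)$, and the coefficient of $x^j$ is a
polynomial in finitely many counts whose coefficients can be read off (`eval_expCoeff_logOf`,
`coeff_expCoeff`). Its degree is attained by a power of the variable of the word $10$.

For uniqueness (`eq_zero_of_eval_blockCount`), restrict to finitely many words. The count vectors of
multiples of a large $p^M$ form an additive monoid under concatenation, and they span the space. In
characteristic $0$ the Zariski closure of a submonoid is a linear subspace, so a polynomial
vanishing on these vectors is zero. -/

/-! ### Logarithm and exponential of power series -/

namespace PowerSeries

variable {K : Type*} [Field K] [CharZero K]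

omit [CharZero K] in
theorem hasSubst_sub_one {f : K⟦X⟧} (hf : constantCoeff f = 1) : HasSubst (f - 1) :=
  HasSubst.of_constantCoeff_zero' (by simp [hf])

theorem derivative_logOf_mul {f : K⟦X⟧} (hf : constantCoeff f = 1) :
    derivative K (logOf f) * f = derivative K f := by
  have h1 : derivative K (log K) * (1 + X) = 1 := by
    rw [deriv_log]
    ext n
    rw [mul_add, mul_one, map_add]
    cases n with
    | zero => simp
    | succ n => simp [coeff_succ_mul_X, pow_succ, coeff_one]
  have hs := hasSubst_sub_one hf
  have h2 : (derivative K (log K)).subst (f - 1) * f = 1 := by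
    have := congrArg (fun g : K⟦X⟧ => (substAlgHom hs) g) h1
    simp only [map_mul, map_add, map_one, substAlgHom_X] at this
    rw [coe_substAlgHom] at this
    simpa using this
  rw [logOf_eq, derivative_subst hs, mul_right_comm, h2, map_sub, derivative_one, sub_zero, one_mul]

/-- Both sides solve $f y'=a f' y$ with $y(0)=1$; their quotient has derivative zero, so in
characteristic $0$ it is constant. -/
theorem exp_subst_natCast_mul_logOf {f : K⟦X⟧} (hf : constantCoeff f = 1) (a : ℕ) :
    (exp K).subst ((a : K⟦X⟧) * logOf f) = f ^ a := by
  have hL : constantCoeff ((a : K⟦X⟧) * logOf f) = 0 := by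
    rw [map_mul, constantCoeff_logOf hf, mul_zero]
  have hs : HasSubst ((a : K⟦X⟧) * logOf f) := HasSubst.of_constantCoeff_zero' hL
  have hf0 : f * f⁻¹ = 1 := PowerSeries.mul_inv_cancel f (by simp [hf])
  set G := (exp K).subst ((a : K⟦X⟧) * logOf f) with hG
  have hd : derivative K G * f = a * G * derivative K f := by
    rw [hG, derivative_subst hs, derivative_exp, Derivation.leibniz, ← derivative_logOf_mul hf]
    simp
    ring
  have hc : constantCoeff G = 1 := by
    have : G = (substAlgHom hs) (exp K - 1) + 1 := by
      rw [map_sub, map_one, coe_substAlgHom, hG, sub_add_cancel]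
    rw [this, map_add, map_one, coe_substAlgHom]
    have h0 := constantCoeff_subst_eq_zero (a := (a : K⟦X⟧) * logOf f) hL (exp K - 1) (by simp)
    rw [constantCoeff_eq, h0, zero_add]
  have hmain : G * f⁻¹ ^ a = 1 := by
    refine derivative.ext ?_ (by simp [hc, hf])
    rw [Derivation.leibniz, derivative_pow, derivative_inv', derivative_one]
    have hdG : derivative K G = a * G * derivative K f * f⁻¹ := by
      rw [← hd, mul_assoc, hf0, mul_one]
    rw [hdG]
    simp only [smul_eq_mul]
    cases a with
    | zero => simp
    | succ a => rw [Nat.add_sub_cancel]; ring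
  calc G = G * f⁻¹ ^ a * f ^ a := by rw [mul_assoc, ← mul_pow, mul_comm f⁻¹, hf0, one_pow, mul_one]
    _ = f ^ a := by rw [hmain, one_mul]

/-- Since $X$ divides $\log f$, the terms of the exponential series beyond $k=j$ vanish modulo
$X^{j+1}$. -/
theorem X_pow_succ_dvd_sum_exp_sub {f : K⟦X⟧} (hf : constantCoeff f = 1) (a j : ℕ) :
    (X : K⟦X⟧) ^ (j + 1) ∣
      ∑ k ∈ Finset.range (j + 1), (a : K⟦X⟧) ^ k * (C ((k.factorial : K)⁻¹) * logOf f ^ k) -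
        f ^ a := by
  have hL : constantCoeff ((a : K⟦X⟧) * logOf f) = 0 := by
    rw [map_mul, constantCoeff_logOf hf, mul_zero]
  rw [← exp_subst_natCast_mul_logOf hf a, X_pow_dvd_iff]
  intro i hi
  rw [map_sub, coeff_subst' (HasSubst.of_constantCoeff_zero' hL), sub_eq_zero,
    finsum_eq_sum_of_support_subset (s := Finset.range (j + 1)), map_sum]
  · refine Finset.sum_congr rfl fun k _ => ?_
    rw [coeff_exp, mul_pow, mul_left_comm, coeff_C_mul]
    simp
  · intro d hd
    rw [Finset.coe_range, Set.mem_Iio]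
    by_contra hdj
    refine hd ?_
    have : (X : K⟦X⟧) ^ d ∣ ((a : K⟦X⟧) * logOf f) ^ d := pow_dvd_pow_of_dvd (X_dvd_iff.2 hL) d
    show _ • coeff i _ = 0
    rw [X_pow_dvd_iff.1 this i (by omega), smul_zero]

theorem X_pow_dvd_logOf {f : K⟦X⟧} {d : ℕ} (hd : 1 ≤ d) (h : (X : K⟦X⟧) ^ d ∣ f - 1) :
    (X : K⟦X⟧) ^ d ∣ logOf f := by
  have h1 : (X : K⟦X⟧) ∣ f - 1 := (dvd_pow_self X (by omega)).trans h
  have hs : HasSubst (f - 1) := HasSubst.of_constantCoeff_zero' (X_dvd_iff.1 h1)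
  obtain ⟨g, hg⟩ := X_dvd_iff.2 (constantCoeff_log (A := K))
  rw [logOf_eq, hg, subst_mul hs, subst_X hs]
  exact h.mul_right _

theorem coeff_one_logOf {f : K⟦X⟧} (hf : constantCoeff f = 1) :
    coeff 1 (logOf f) = coeff 1 f := by
  have h := congrArg (coeff 0) (derivative_logOf_mul hf)
  rw [coeff_zero_eq_constantCoeff_apply, map_mul, hf, mul_one,
    ← coeff_zero_eq_constantCoeff_apply, coeff_derivative, coeff_derivative] at h
  simpa using h

end PowerSeries

/-! ### Coefficients of a formal exponential in many variables -/

theorem Finset.sum_finsupp_prod {σ R : Type*} [CommSemiring R] (F : Finset σ)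
    (t : σ → Finset ℕ) (g : σ → ℕ → R) :
    ∑ m ∈ F.finsupp t, ∏ w ∈ F, g w (m w) = ∏ w ∈ F, ∑ k ∈ t w, g w k := by
  classical
  rw [Finset.prod_sum, Finset.finsupp, Finset.sum_map]
  refine Finset.sum_congr (by congr!) fun q _ => ?_
  rw [← Finset.prod_attach]
  refine Finset.prod_congr rfl fun w _ => ?_
  congr 1
  exact Finsupp.indicator_of_mem w.2 q

open PowerSeries in
/-- The product of the series `L w ^ k / k!` over the variables `w` of a monomial. -/
noncomputable def expMonomial {σ K : Type*} [Field K] (L : σ → K⟦X⟧) (m : σ →₀ ℕ) : K⟦X⟧ :=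
  m.prod fun w k => C ((k.factorial : K)⁻¹) * L w ^ k

/-- The degree-`j` coefficient of `exp (∑ w ∈ F, L w * X_w)`, in case that all `L w` have order at
least one. -/
noncomputable def expCoeff {σ K : Type*} [Field K] (L : σ → PowerSeries K) (F : Finset σ) (j : ℕ) :
    MvPolynomial σ K :=
  ∑ m ∈ F.finsupp fun _ => Finset.range (j + 1),
    MvPolynomial.monomial m (PowerSeries.coeff j (expMonomial L m))

section expCoeff

open PowerSeries

variable {σ K : Type*} [Field K]

theorem X_pow_dvd_expMonomial {L : σ → K⟦X⟧} (hL : ∀ w, (X : K⟦X⟧) ∣ L w) (m : σ →₀ ℕ) :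
    (X : K⟦X⟧) ^ (m.sum fun _ k => k) ∣ expMonomial L m := by
  rw [expMonomial, Finsupp.prod, Finsupp.sum, ← Finset.prod_pow_eq_pow_sum]
  exact Finset.prod_dvd_prod_of_dvd _ _ fun w _ => (pow_dvd_pow_of_dvd (hL w) _).mul_left _

theorem dvd_expMonomial {L : σ → K⟦X⟧} {m : σ →₀ ℕ} {w : σ} (hw : w ∈ m.support) :
    L w ∣ expMonomial L m := by
  refine dvd_trans ?_ (Finset.dvd_prod_of_mem _ hw)
  exact (dvd_pow_self _ (Finsupp.mem_support_iff.1 hw)).mul_left _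

variable {L : σ → K⟦X⟧} {d : σ → ℕ} (hd : ∀ w, 1 ≤ d w) (hL : ∀ w, (X : K⟦X⟧) ^ d w ∣ L w)

-- Truncating to variables in `F` and exponents at most `j` loses nothing: a variable with `d w > j`
-- or an exponent above `j` makes the monomial's series divisible by $X^{j+1}$.
include hd hL in
theorem coeff_expCoeff {F : Finset σ} {j : ℕ} (hF : ∀ w, d w ≤ j → w ∈ F) (m : σ →₀ ℕ) :
    MvPolynomial.coeff m (expCoeff L F j) = coeff j (expMonomial L m) := by
  classical
  have hL1 : ∀ w, (X : K⟦X⟧) ∣ L w := fun w =>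
    (dvd_pow_self X (by have := hd w; omega)).trans (hL w)
  rw [expCoeff, MvPolynomial.coeff_sum]
  simp only [MvPolynomial.coeff_monomial]
  rw [Finset.sum_ite_eq']
  split_ifs with h
  · rfl
  · symm
    contrapose! h
    rw [Finset.mem_finsupp_iff]
    refine ⟨fun w hw => hF w ?_, fun w _ => ?_⟩
    · by_contra hj
      exact h (X_pow_dvd_iff.1 ((hL w).trans (dvd_expMonomial hw)) j (by omega))
    · rw [Finset.mem_range]
      by_contra hj
      refine h (X_pow_dvd_iff.1 (X_pow_dvd_expMonomial hL1 m) j ?_)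
      have hw : w ∈ m.support := by rw [Finsupp.mem_support_iff]; omega
      have := Finset.single_le_sum (f := m) (fun _ _ => Nat.zero_le _) hw
      rw [Finsupp.sum]
      omega

include hd hL in
theorem totalDegree_expCoeff_le {F : Finset σ} {j : ℕ} (hF : ∀ w, d w ≤ j → w ∈ F) :
    (expCoeff L F j).totalDegree ≤ j := by
  have hL1 : ∀ w, (X : K⟦X⟧) ∣ L w := fun w =>
    (dvd_pow_self X (by have := hd w; omega)).trans (hL w)
  refine Finset.sup_le fun m hm => ?_
  rw [MvPolynomial.mem_support_iff, coeff_expCoeff hd hL hF] at hm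
  by_contra hj
  exact hm (X_pow_dvd_iff.1 (X_pow_dvd_expMonomial hL1 m) j (by omega))

include hd hL in
theorem le_of_mem_vars_expCoeff {F : Finset σ} {j : ℕ} (hF : ∀ w, d w ≤ j → w ∈ F) {w : σ}
    (hw : w ∈ (expCoeff L F j).vars) : d w ≤ j := by
  obtain ⟨m, hm, hwm⟩ := (MvPolynomial.mem_vars_iff_mem_support w).1 hw
  rw [MvPolynomial.mem_support_iff, coeff_expCoeff hd hL hF] at hm
  by_contra hj
  exact hm (X_pow_dvd_iff.1 ((hL w).trans (dvd_expMonomial hwm)) j (by omega))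

-- The pure power $X_w^j$ survives: its coefficient is $\ell^j/j!$, where $\ell$ is the linear
-- coefficient of `L w`.
include hd hL in
theorem totalDegree_expCoeff {F : Finset σ} {j : ℕ} [CharZero K] (hF : ∀ w, d w ≤ j → w ∈ F)
    {w : σ} (hw : coeff 1 (L w) ≠ 0) : (expCoeff L F j).totalDegree = j := by
  refine le_antisymm (totalDegree_expCoeff_le hd hL hF) ?_
  have hX : (X : K⟦X⟧) ∣ L w := (dvd_pow_self X (by have := hd w; omega)).trans (hL w)
  obtain ⟨g, hg⟩ := hX
  have hg0 : constantCoeff g ≠ 0 := by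
    rwa [hg, mul_comm, coeff_succ_mul_X, coeff_zero_eq_constantCoeff_apply] at hw
  have hmem : Finsupp.single w j ∈ (expCoeff L F j).support := by
    rw [MvPolynomial.mem_support_iff, coeff_expCoeff hd hL hF, expMonomial,
      Finsupp.prod_single_index (by simp), coeff_C_mul, hg, mul_pow, coeff_X_pow_mul', if_pos le_rfl,
      Nat.sub_self, coeff_zero_eq_constantCoeff_apply, map_pow]
    exact mul_ne_zero (inv_ne_zero (by exact_mod_cast j.factorial_ne_zero)) (pow_ne_zero _ hg0)
  have := MvPolynomial.le_totalDegree hmem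
  rwa [Finsupp.sum_single_index rfl] at this

theorem eval_expCoeff_logOf [CharZero K] {r : σ → K⟦X⟧} (hr : ∀ w, constantCoeff (r w) = 1)
    (F : Finset σ) (j : ℕ) (x : σ → ℕ) :
    MvPolynomial.eval (fun w => (x w : K)) (expCoeff (fun w => logOf (r w)) F j) =
      coeff j (∏ w ∈ F, r w ^ x w) := by
  have h1 : MvPolynomial.eval (fun w => (x w : K)) (expCoeff (fun w => logOf (r w)) F j) =
      coeff j (∏ w ∈ F, ∑ k ∈ Finset.range (j + 1),
        (x w : K⟦X⟧) ^ k * (C ((k.factorial : K)⁻¹) * logOf (r w) ^ k)) := by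
    rw [← Finset.sum_finsupp_prod, expCoeff, map_sum, map_sum]
    refine Finset.sum_congr rfl fun m hm => ?_
    have hs := (Finset.mem_finsupp_iff.1 hm).1
    rw [MvPolynomial.eval_monomial, Finset.prod_mul_distrib, expMonomial,
      Finsupp.prod_of_support_subset _ hs _ (by simp),
      Finsupp.prod_of_support_subset _ hs _ (by simp)]
    have : ∏ w ∈ F, (x w : K⟦X⟧) ^ m w = C (∏ w ∈ F, (x w : K) ^ m w) := by
      rw [map_prod]
      exact Finset.prod_congr rfl fun w _ => by simp
    rw [this, coeff_C_mul, mul_comm]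
  have h2 : (X : K⟦X⟧) ^ (j + 1) ∣ ∏ w ∈ F, (∑ k ∈ Finset.range (j + 1),
        (x w : K⟦X⟧) ^ k * (C ((k.factorial : K)⁻¹) * logOf (r w) ^ k)) -
      ∏ w ∈ F, r w ^ x w := by
    -- In the quotient ring modulo $X^{j+1}$ the two products can be compared factor by factor.
    rw [← Ideal.mem_span_singleton, ← Ideal.Quotient.eq, map_prod, map_prod]
    refine Finset.prod_congr rfl fun w _ => ?_
    rw [Ideal.Quotient.eq, Ideal.mem_span_singleton]
    exact X_pow_succ_dvd_sum_exp_sub (hr w) (x w) j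
  rw [h1, ← sub_eq_zero, ← map_sub]
  exact X_pow_dvd_iff.1 h2 j (Nat.lt_succ_self j)

end expCoeff

/-! ### Zariski density of spanning submonoids -/

/-- Over an infinite domain, a polynomial vanishing on an additive submonoid that spans the whole
space is zero. -/
theorem MvPolynomial.eq_zero_of_eval_addSubmonoid {σ K : Type*} [Field K] [CharZero K]
    (S : AddSubmonoid (σ → K)) (hS : Submodule.span K (S : Set (σ → K)) = ⊤)
    {Q : MvPolynomial σ K} (hQ : ∀ s ∈ S, MvPolynomial.eval s Q = 0) : Q = 0 := by
  -- `Z` is the Zariski closure of `S`; it will be shown to be a linear subspace.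
  let Z : Set (σ → K) := {x | ∀ R : MvPolynomial σ K, (∀ s ∈ S, eval s R = 0) → eval x R = 0}
  have hSZ : ∀ s ∈ S, s ∈ Z := fun s hs R hR => hR s hs
  let shift (y : σ → K) (R : MvPolynomial σ K) : MvPolynomial σ K := bind₁ (fun i => X i + C (y i)) R
  have hshift : ∀ y x R, eval x (shift y R) = eval (x + y) R := by
    intro y x R
    simp only [shift]
    rw [eval, eval₂Hom_bind₁]
    congr 2
    funext i
    simp
  -- Closure under addition takes two passes: translating by an element of `S` preserves vanishing
  -- on `S`; with this known, translating by an element of `Z` does too.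
  have hadd1 : ∀ x ∈ Z, ∀ s ∈ S, x + s ∈ Z := by
    intro x hx s hs R hR
    rw [← hshift]
    exact hx _ fun t ht => by rw [hshift]; exact hR _ (S.add_mem ht hs)
  have hadd : ∀ x ∈ Z, ∀ y ∈ Z, x + y ∈ Z := by
    intro x hx y hy R hR
    rw [← hshift]
    refine hx _ fun t ht => ?_
    rw [hshift, add_comm]
    exact hadd1 y hy t ht R hR
  have hnat : ∀ x ∈ Z, ∀ n : ℕ, (n : K) • x ∈ Z := by
    intro x hx n
    induction n with
    | zero => simpa using hSZ 0 S.zero_mem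
    | succ n ih =>
      rw [Nat.cast_succ, add_smul, one_smul]
      exact hadd _ ih _ hx
  have hsmul : ∀ (c : K), ∀ x ∈ Z, c • x ∈ Z := by
    intro c x hx R hR
    -- The restriction of `R` to the line through `x` vanishes at all natural numbers, hence
    -- identically.
    let q : Polynomial K := aeval (fun i => Polynomial.C (x i) * Polynomial.X) R
    have hq : ∀ t : K, q.eval t = eval (t • x) R := by
      intro t
      simp only [q]
      rw [← Polynomial.coe_evalRingHom, aeval_def, ← coe_eval₂Hom, ← RingHom.comp_apply,
        comp_eval₂Hom, eval]
      congr 2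
      · exact RingHom.ext fun a => Polynomial.eval_C
      · funext i
        show Polynomial.eval t (Polynomial.C (x i) * Polynomial.X) = t * x i
        rw [Polynomial.eval_C_mul, Polynomial.eval_X, mul_comm]
    have hq0 : q = 0 := by
      refine Polynomial.eq_zero_of_infinite_isRoot q ?_
      refine (Set.infinite_range_of_injective (Nat.cast_injective (R := K))).mono ?_
      rintro _ ⟨n, rfl⟩
      show q.eval _ = 0
      rw [hq]
      exact hnat x hx n R hR
    rw [← hq, hq0, Polynomial.eval_zero]
  let ZS : Submodule K (σ → K) :=
    { carrier := Z
      add_mem' := fun {x y} hx hy => hadd x hx y hy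
      zero_mem' := hSZ 0 S.zero_mem
      smul_mem' := hsmul }
  have htop : ZS = ⊤ := by
    rw [eq_top_iff, ← hS, Submodule.span_le]
    exact hSZ
  refine MvPolynomial.funext fun x => ?_
  rw [map_zero]
  have : x ∈ ZS := htop ▸ Submodule.mem_top
  exact this Q hQ

/-- A unitriangular family with respect to a length function spans the space. -/
theorem span_eq_top_of_unitriangular {σ K : Type*} [Field K] [Finite σ] (len : σ → ℕ)
    (s : σ → σ → K) (hdiag : ∀ v, s v v = 1) (hoff : ∀ v w, len v ≤ len w → v ≠ w → s v w = 0)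
    (V : Submodule K (σ → K)) (hV : ∀ v, s v ∈ V) : V = ⊤ := by
  classical
  have := Fintype.ofFinite σ
  have hsingle : ∀ N, ∀ v, len v = N → (Pi.single v 1 : σ → K) ∈ V := by
    intro N
    induction N using Nat.strong_induction_on with
    | _ N ih =>
      intro v hv
      have h : (Pi.single v 1 : σ → K) =
          s v - ∑ w with len w < N, s v w • (Pi.single w 1 : σ → K) := by
        funext u
        simp only [Pi.sub_apply, Finset.sum_apply, Pi.smul_apply, smul_eq_mul, Pi.single_apply,
          mul_ite, mul_one, mul_zero]
        rw [Finset.sum_ite_eq]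
        by_cases huv : u = v
        · subst huv; simp [hdiag, hv]
        · by_cases hu : len u < N
          · simp [hu, huv]
          · simp [hu, huv, hoff v u (by omega) (Ne.symm huv)]
      rw [h]
      refine V.sub_mem (hV v) (V.sum_mem fun w hw => V.smul_mem _ ?_)
      exact ih _ (Finset.mem_filter.1 hw).2 w rfl
  rw [eq_top_iff]
  intro x _
  rw [pi_eq_sum_univ' x]
  exact V.sum_mem fun i _ => V.smul_mem _ (by
    convert hsingle _ i rfl using 1)

/-! ### Recursion in the lowest digit -/

section Recurrence

variable {p : ℕ}

theorem padicValNat_factorial_mul_add_digit [Fact p.Prime] (n : ℕ) {d : ℕ} (hd : d < p) :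
    padicValNat p (p * n + d).factorial = padicValNat p n.factorial + n := by
  rw [padicValNat_factorial_mul_add n hd, padicValNat_factorial_mul]

theorem padicValNat_choose_add [Fact p.Prime] (s u : ℕ) :
    padicValNat p ((s + u).choose s) + padicValNat p s.factorial + padicValNat p u.factorial =
      padicValNat p (s + u).factorial := by
  rw [← padicValNat.mul (Nat.choose_pos (Nat.le_add_right s u)).ne' s.factorial_ne_zero,
    ← padicValNat.mul (mul_ne_zero (Nat.choose_pos (Nat.le_add_right s u)).ne'
      s.factorial_ne_zero) u.factorial_ne_zero, Nat.choose_symm_add,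
    Nat.add_choose_mul_factorial_mul_factorial]

theorem padicValNat_succ_mul_choose_add [Fact p.Prime] (s u : ℕ) :
    padicValNat p ((s + u + 1) * (s + u).choose s) + padicValNat p s.factorial +
      padicValNat p u.factorial = padicValNat p (s + u + 1).factorial := by
  rw [padicValNat.mul (Nat.succ_ne_zero _) (Nat.choose_pos (Nat.le_add_right s u)).ne',
    Nat.factorial_succ, padicValNat.mul (Nat.succ_ne_zero _) (Nat.factorial_ne_zero _),
    ← padicValNat_choose_add s u]
  ring

/-- No borrow occurs at the lowest digit, so the linear terms contributed by the three factorials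
cancel. -/
theorem padicValNat_choose_of_le [Fact p.Prime] {n s d e : ℕ} (hd : d < p) (he : e ≤ d)
    (hs : s ≤ n) :
    padicValNat p ((p * n + d).choose (p * s + e)) = padicValNat p (n.choose s) := by
  obtain ⟨u, rfl⟩ := Nat.exists_eq_add_of_le hs
  obtain ⟨c, rfl⟩ := Nat.exists_eq_add_of_le he
  have h1 := padicValNat_choose_add (p := p) s u
  have h2 := padicValNat_choose_add (p := p) (p * s + e) (p * u + c)
  have h3 : p * s + e + (p * u + c) = p * (s + u) + (e + c) := by ring
  rw [h3, padicValNat_factorial_mul_add_digit _ hd,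
    padicValNat_factorial_mul_add_digit _ (show e < p by omega),
    padicValNat_factorial_mul_add_digit _ (show c < p by omega)] at h2
  omega

/-- A borrow replaces the complementary quotient $n-s$ by $n-1-s$: the linear terms leave $1$, and
the remaining factorials are those of $n\binom{n-1}{s}=n!/(s!\,(n-1-s)!)$. This is the origin of the
companion. -/
theorem padicValNat_choose_of_lt [Fact p.Prime] {n s d e : ℕ} (hd : d < p) (he : d < e)
    (hep : e < p) (hs : s < n) :
    padicValNat p ((p * n + d).choose (p * s + e)) =
      padicValNat p (n * (n - 1).choose s) + 1 := by
  obtain ⟨u, rfl⟩ := Nat.exists_eq_add_of_lt hs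
  -- `c` is the lowest digit of the difference after the borrow.
  obtain ⟨c, hc⟩ := Nat.exists_eq_add_of_le (show e ≤ p + d by omega)
  have h1 := padicValNat_succ_mul_choose_add (p := p) s u
  have h2 := padicValNat_choose_add (p := p) (p * s + e) (p * u + c)
  have h3 : p * s + e + (p * u + c) = p * (s + u + 1) + d := by
    calc p * s + e + (p * u + c) = p * s + p * u + (e + c) := by ring
      _ = _ := by rw [← hc]; ring
  rw [h3, padicValNat_factorial_mul_add_digit _ hd,
    padicValNat_factorial_mul_add_digit _ hep,
    padicValNat_factorial_mul_add_digit _ (show c < p by omega)] at h2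
  rw [Nat.add_sub_cancel]
  omega

theorem padicValNat_mul_choose_of_lt [Fact p.Prime] {n s d e : ℕ} (hd : d < p) (he : e < d)
    (hs : s ≤ n) :
    padicValNat p ((p * n + d) * (p * n + d - 1).choose (p * s + e)) =
      padicValNat p (n.choose s) := by
  obtain ⟨u, rfl⟩ := Nat.exists_eq_add_of_le hs
  obtain ⟨c, rfl⟩ := Nat.exists_eq_add_of_lt he
  have h1 := padicValNat_choose_add (p := p) s u
  have h2 := padicValNat_succ_mul_choose_add (p := p) (p * s + e) (p * u + c)
  have h3 : p * s + e + (p * u + c) = p * (s + u) + (e + c + 1) - 1 := by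
    rw [← Nat.add_assoc (p * (s + u)), Nat.add_sub_cancel]; ring
  have h4 : p * s + e + (p * u + c) + 1 = p * (s + u) + (e + c + 1) := by ring
  rw [h4, h3, padicValNat_factorial_mul_add_digit _ hd,
    padicValNat_factorial_mul_add_digit _ (show e < p by omega),
    padicValNat_factorial_mul_add_digit _ (show c < p by omega)] at h2
  omega

theorem padicValNat_mul_choose_of_le [Fact p.Prime] {n s d e : ℕ} (hd : d < p) (he : d ≤ e)
    (hep : e < p) (hs : s < n) :
    padicValNat p ((p * n + d) * (p * n + d - 1).choose (p * s + e)) =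
      padicValNat p (n * (n - 1).choose s) + 1 := by
  obtain ⟨u, rfl⟩ := Nat.exists_eq_add_of_lt hs
  obtain ⟨c, hc⟩ := Nat.exists_eq_add_of_lt (show e < p + d by omega)
  have h1 := padicValNat_succ_mul_choose_add (p := p) s u
  have h2 := padicValNat_succ_mul_choose_add (p := p) (p * s + e) (p * u + c)
  have h4 : p * s + e + (p * u + c) + 1 = p * (s + u + 1) + d := by
    calc p * s + e + (p * u + c) + 1 = p * s + p * u + (e + c + 1) := by ring
      _ = _ := by rw [← hc]; ring
  have h3 : p * s + e + (p * u + c) = p * (s + u + 1) + d - 1 := by omega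
  rw [h4, h3, padicValNat_factorial_mul_add_digit _ hd,
    padicValNat_factorial_mul_add_digit _ hep,
    padicValNat_factorial_mul_add_digit _ (show c < p by omega)] at h2
  rw [Nat.add_sub_cancel]
  omega

/-- Summation over a range according to quotient and remainder, for a summand that depends on the
remainder `e` only through `e < m`. -/
theorem Finset.sum_range_mul_add_of_eq {R : Type*} [Semiring R] {m n : ℕ} (hm : m ≤ p)
    (f A B : ℕ → R) (hA : ∀ s ≤ n, ∀ e < m, f (p * s + e) = A s)
    (hB : ∀ s < n, ∀ e, m ≤ e → e < p → f (p * s + e) = B s) :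
    ∑ t ∈ range (p * n + m), f t =
      m * ∑ s ∈ range (n + 1), A s + (p - m : ℕ) * ∑ s ∈ range n, B s := by
  have hmul : ∀ k ≤ n, ∑ t ∈ range (p * k), f t =
      m * ∑ s ∈ range k, A s + (p - m : ℕ) * ∑ s ∈ range k, B s := by
    intro k hk
    induction k with
    | zero => simp
    | succ k ih =>
      obtain ⟨c, rfl⟩ := Nat.exists_eq_add_of_le hm
      have h1 : ∑ e ∈ range m, f ((m + c) * k + e) = ∑ e ∈ range m, A k :=
        Finset.sum_congr rfl fun e he => hA k (by omega) e (mem_range.1 he)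
      have h2 : ∑ e ∈ range c, f ((m + c) * k + (m + e)) = ∑ e ∈ range c, B k :=
        Finset.sum_congr rfl fun e he =>
          hB k (by omega) (m + e) (by omega) (by have := mem_range.1 he; omega)
      rw [mul_add_one, sum_range_add, ih (by omega), sum_range_add, sum_range_succ, sum_range_succ,
        h1, h2]
      simp only [sum_const, card_range, nsmul_eq_mul, Nat.add_sub_cancel_left, mul_add]
      abel
  rw [sum_range_add, hmul n le_rfl, sum_range_succ,
    Finset.sum_congr rfl fun e he => hA n le_rfl e (mem_range.1 he)]
  simp only [sum_const, card_range, nsmul_eq_mul, mul_add]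
  abel

variable (K : Type*) [Field K]

/-- The companion `∑ x ^ ν_p(n * (n - 1).choose t)` of `rowPoly`, the sum being over
`0 ≤ t ≤ n - 1`. -/
noncomputable def companionPoly (p n : ℕ) : Polynomial K :=
  ∑ t ∈ Finset.range n, Polynomial.X ^ padicValNat p (n * (n - 1).choose t)

/-- Sort the `t` by lowest digit: $d+1$ digits cause no borrow, the other $p-1-d$ do. -/
theorem rowPoly_mul_add (hp : p.Prime) (n : ℕ) {d : ℕ} (hd : d < p) :
    rowPoly K p (p * n + d) = ((d + 1 : ℕ) : Polynomial K) * rowPoly K p n +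
      ((p - (d + 1) : ℕ) : Polynomial K) * (Polynomial.X * companionPoly K p n) := by
  have := Fact.mk hp
  rw [rowPoly, Nat.add_assoc, Finset.sum_range_mul_add_of_eq (p := p) hd _
    (fun s => Polynomial.X ^ padicValNat p (n.choose s))
    (fun s => Polynomial.X ^ (padicValNat p (n * (n - 1).choose s) + 1))]
  · simp only [rowPoly, companionPoly, Finset.mul_sum, pow_succ']
  · intro s hs e he
    rw [padicValNat_choose_of_le hd (by omega) hs]
  · intro s hs e he hep
    rw [padicValNat_choose_of_lt hd (by omega) hep hs]

theorem companionPoly_mul_add (hp : p.Prime) (n : ℕ) {d : ℕ} (hd : d < p) :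
    companionPoly K p (p * n + d) = (d : Polynomial K) * rowPoly K p n +
      ((p - d : ℕ) : Polynomial K) * (Polynomial.X * companionPoly K p n) := by
  have := Fact.mk hp
  rw [companionPoly, Finset.sum_range_mul_add_of_eq (p := p) hd.le _
    (fun s => Polynomial.X ^ padicValNat p (n.choose s))
    (fun s => Polynomial.X ^ (padicValNat p (n * (n - 1).choose s) + 1))]
  · simp only [rowPoly, companionPoly, Finset.mul_sum, pow_succ']
  · intro s hs e he
    rw [padicValNat_mul_choose_of_lt hd (by omega) hs]
  · intro s hs e he hep
    rw [padicValNat_mul_choose_of_le hd (by omega) hep hs]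

theorem rowPoly_coeff (n j : ℕ) : (rowPoly K p n).coeff j = (rowCount p j n : K) := by
  simp [rowPoly, rowCount, Polynomial.finsetSum_coeff, Polynomial.coeff_X_pow, eq_comm,
    Finset.sum_boole]

theorem normRowPoly_coeff (n j : ℕ) :
    (normRowPoly K p n).coeff j = (rowCount p j n : K) / rowCount p 0 n := by
  rw [normRowPoly, Polynomial.coeff_C_mul, rowPoly_coeff, div_eq_inv_mul]

theorem rowCount_zero_mul_add (hp : p.Prime) (n : ℕ) {d : ℕ} (hd : d < p) :
    (rowCount p 0 (p * n + d) : K) = (d + 1) * rowCount p 0 n := by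
  rw [← rowPoly_coeff, rowPoly_mul_add K hp n hd, Polynomial.coeff_add, mul_left_comm,
    Polynomial.mul_coeff_zero Polynomial.X, Polynomial.coeff_X_zero, zero_mul, add_zero,
    ← rowPoly_coeff, Polynomial.mul_coeff_zero, Polynomial.natCast_coeff_zero]
  push_cast
  rfl

variable [CharZero K]

theorem rowCount_zero_ne_zero (n : ℕ) : (rowCount p 0 n : K) ≠ 0 := by
  have h := normRowPoly_coeff_zero K p n
  rw [normRowPoly_coeff] at h
  intro h0
  simp [h0] at h

/-- The companion polynomial normalized like `normRowPoly`. -/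
noncomputable def normCompanionPoly (p n : ℕ) : Polynomial K :=
  Polynomial.C ((rowCount p 0 n : K)⁻¹) * companionPoly K p n

/-- The companion drops out exactly for $d=p-1$, which is why admissible words exclude this
rightmost digit. -/
theorem normRowPoly_mul_add (hp : p.Prime) (n : ℕ) {d : ℕ} (hd : d < p) :
    normRowPoly K p (p * n + d) = normRowPoly K p n +
      Polynomial.C ((p - 1 - d : K) / (d + 1)) * (Polynomial.X * normCompanionPoly K p n) := by
  have h1 : (d + 1 : K) ≠ 0 := by exact_mod_cast Nat.succ_ne_zero d
  have h2 : (rowCount p 0 n : K) ≠ 0 := rowCount_zero_ne_zero K n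
  rw [normRowPoly, rowPoly_mul_add K hp n hd, rowCount_zero_mul_add K hp n hd, normRowPoly,
    normCompanionPoly, ← Polynomial.C_eq_natCast, ← Polynomial.C_eq_natCast, mul_add, ← mul_assoc,
    ← mul_assoc, ← Polynomial.C_mul, ← Polynomial.C_mul, mul_left_comm Polynomial.X,
    ← mul_assoc (Polynomial.C _) (Polynomial.C _), ← Polynomial.C_mul]
  congr 3
  · push_cast; field_simp
  · rw [Nat.cast_sub (by omega)]; push_cast; field_simp; ring

theorem normCompanionPoly_mul_add (hp : p.Prime) (n : ℕ) {d : ℕ} (hd : d < p) :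
    normCompanionPoly K p (p * n + d) = Polynomial.C ((d : K) / (d + 1)) * normRowPoly K p n +
      Polynomial.C ((p - d : K) / (d + 1)) * (Polynomial.X * normCompanionPoly K p n) := by
  have h1 : (d + 1 : K) ≠ 0 := by exact_mod_cast Nat.succ_ne_zero d
  have h2 : (rowCount p 0 n : K) ≠ 0 := rowCount_zero_ne_zero K n
  rw [normCompanionPoly, companionPoly_mul_add K hp n hd, rowCount_zero_mul_add K hp n hd,
    normRowPoly, normCompanionPoly, ← Polynomial.C_eq_natCast, ← Polynomial.C_eq_natCast, mul_add,
    ← mul_assoc, ← mul_assoc, ← Polynomial.C_mul, ← Polynomial.C_mul, mul_left_comm Polynomial.X,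
    ← mul_assoc (Polynomial.C _) (Polynomial.C _), ← mul_assoc (Polynomial.C _) (Polynomial.C _),
    ← Polynomial.C_mul, ← Polynomial.C_mul]
  congr 3
  · field_simp
  · rw [Nat.cast_sub hd.le]; field_simp

omit [CharZero K] in
theorem normRowPoly_zero : normRowPoly K p 0 = 1 := by
  simp [normRowPoly, rowPoly, rowCount, Finset.filter_singleton, em]

omit [CharZero K] in
theorem normCompanionPoly_zero : normCompanionPoly K p 0 = 0 := by
  simp [normCompanionPoly, companionPoly]

theorem normRowPoly_of_lt (hp : p.Prime) {d : ℕ} (hd : d < p) : normRowPoly K p d = 1 := by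
  have h := normRowPoly_mul_add K hp 0 hd
  rwa [mul_zero, zero_add, normCompanionPoly_zero, mul_zero, mul_zero, add_zero,
    normRowPoly_zero] at h

theorem normCompanionPoly_of_lt (hp : p.Prime) {d : ℕ} (hd : d < p) :
    normCompanionPoly K p d = Polynomial.C ((d : K) / (d + 1)) := by
  have h := normCompanionPoly_mul_add K hp 0 hd
  rwa [mul_zero, zero_add, normCompanionPoly_zero, mul_zero, mul_zero, add_zero,
    normRowPoly_zero, mul_one] at h

/-- The pairs `(normRowPoly, normCompanionPoly)` of `m < p ^ k` and of `m` with leading digit `a`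
prepended have determinant a scalar multiple of `X ^ k`. -/
theorem exists_wedge_eq (hp : p.Prime) {a : ℕ} (ha : a < p) (k m : ℕ) (hm : m < p ^ k) :
    ∃ c : K, (a = 0 → c = 0) ∧
      normCompanionPoly K p (m + p ^ k * a) * normRowPoly K p m -
        normRowPoly K p (m + p ^ k * a) * normCompanionPoly K p m =
      Polynomial.C c * Polynomial.X ^ k := by
  induction k generalizing m with
  | zero =>
    obtain rfl : m = 0 := by simpa using hm
    refine ⟨(a : K) / (a + 1), fun h => by simp [h], ?_⟩
    rw [pow_zero, zero_add, one_mul, normRowPoly_zero, normCompanionPoly_zero, mul_zero, sub_zero,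
      mul_one, pow_zero, mul_one, normCompanionPoly_of_lt K hp ha]
  | succ k ih =>
    obtain ⟨c, hc, h⟩ := ih (m / p) (Nat.div_lt_of_lt_mul (by rwa [pow_succ'] at hm))
    have hd : m % p < p := Nat.mod_lt _ hp.pos
    set d := m % p
    set m' := m / p
    have hm' : m = p * m' + d := (Nat.div_add_mod m p).symm
    have hN : m + p ^ (k + 1) * a = p * (m' + p ^ k * a) + d := by rw [hm']; ring
    have h1 : (d + 1 : K) ≠ 0 := by exact_mod_cast Nat.succ_ne_zero d
    -- The transition matrix of the digit `d` has determinant $p\,x/(d+1)^2$.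
    refine ⟨c * (p / (d + 1) ^ 2), fun h0 => by rw [hc h0, zero_mul], ?_⟩
    rw [hN, hm', normRowPoly_mul_add K hp _ hd, normRowPoly_mul_add K hp _ hd,
      normCompanionPoly_mul_add K hp _ hd, normCompanionPoly_mul_add K hp _ hd, pow_succ Polynomial.X,
      Polynomial.C_mul]
    have hdet : (p / (d + 1) ^ 2 : K) =
        (p - d) / (d + 1) - (d / (d + 1)) * ((p - 1 - d) / (d + 1)) := by
      field_simp; ring
    rw [hdet, Polynomial.C_sub, Polynomial.C_mul]
    linear_combination (Polynomial.C ((p - d : K) / (d + 1)) -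
      Polynomial.C ((d : K) / (d + 1)) * Polynomial.C ((p - 1 - d : K) / (d + 1))) *
      Polynomial.X * h

/-- The cross product defining `r_w` for the word `w` with lowest digit `b`, highest digit `a` and
`k` digits in between that represent `m`. -/
theorem exists_cross_eq (hp : p.Prime) {a b : ℕ} (ha : a < p) (hb : b < p) (k m : ℕ)
    (hm : m < p ^ k) :
    ∃ c : K, (a = 0 → c = 0) ∧ (b = p - 1 → c = 0) ∧
      normRowPoly K p (p * (m + p ^ k * a) + b) * normRowPoly K p m -
        normRowPoly K p (m + p ^ k * a) * normRowPoly K p (p * m + b) =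
      Polynomial.C c * Polynomial.X ^ (k + 1) := by
  obtain ⟨c, hc, h⟩ := exists_wedge_eq K hp ha k m hm
  -- Expanding at the lowest digit `b`, the pure row terms cancel; what remains is
  -- $\frac{p-1-b}{b+1}x$ times the determinant of `exists_wedge_eq`.
  refine ⟨(p - 1 - b : K) / (b + 1) * c, fun h0 => by rw [hc h0, mul_zero], fun h0 => ?_, ?_⟩
  · have := hp.pos
    rw [h0, Nat.cast_sub (by omega), Nat.cast_one, sub_self, zero_div, zero_mul]
  · rw [normRowPoly_mul_add K hp _ hb, normRowPoly_mul_add K hp _ hb, Polynomial.C_mul, pow_succ]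
    linear_combination Polynomial.C ((p - 1 - b : K) / (b + 1)) * Polynomial.X * h

end Recurrence

/-! ### Block counts and their polynomial independence -/

section Window

/-- The `μ` least significant base-`p` digits of `n`, least significant digit first. -/
def digitWindow (p : ℕ) : ℕ → ℕ → List ℕ
  | _, 0 => []
  | n, μ + 1 => n % p :: digitWindow p (n / p) μ

variable {p : ℕ}

@[simp]
theorem length_digitWindow (n μ : ℕ) : (digitWindow p n μ).length = μ := by
  induction μ generalizing n with
  | zero => rfl
  | succ μ ih => simp [digitWindow, ih]

theorem ofDigits_digitWindow (n μ : ℕ) : Nat.ofDigits p (digitWindow p n μ) = n % p ^ μ := by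
  induction μ generalizing n with
  | zero => simp [digitWindow, Nat.mod_one]
  | succ μ ih =>
    rw [digitWindow, Nat.ofDigits_cons, ih, pow_succ', Nat.mod_mul]

theorem digitWindow_lt (hp : 0 < p) (n μ : ℕ) : ∀ d ∈ digitWindow p n μ, d < p := by
  induction μ generalizing n with
  | zero => simp [digitWindow]
  | succ μ ih =>
    intro d hd
    rw [digitWindow, List.mem_cons] at hd
    rcases hd with rfl | hd
    · exact Nat.mod_lt _ hp
    · exact ih _ d hd

theorem digitWindow_ofDigits {w : List ℕ} (hw : ∀ d ∈ w, d < p) :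
    digitWindow p (Nat.ofDigits p w) w.length = w := by
  induction w with
  | nil => rfl
  | cons d w ih =>
    have hd : d < p := hw d (by simp)
    have hp : 0 < p := by omega
    have hcons : Nat.ofDigits p (d :: w) = d + p * Nat.ofDigits p w := rfl
    rw [List.length_cons, digitWindow, hcons, Nat.add_mul_mod_self_left,
      Nat.mod_eq_of_lt hd, Nat.add_mul_div_left _ _ hp, Nat.div_eq_of_lt hd, zero_add,
      ih fun x hx => hw x (by simp [hx])]

theorem digitWindow_congr (hp : 0 < p) {n n' μ : ℕ} (h : n % p ^ μ = n' % p ^ μ) :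
    digitWindow p n μ = digitWindow p n' μ := by
  have key : ∀ n, digitWindow p (n % p ^ μ) μ = digitWindow p n μ := by
    intro n
    have := digitWindow_ofDigits (digitWindow_lt hp n μ)
    rwa [ofDigits_digitWindow, length_digitWindow] at this
  rw [← key n, h, key]

theorem digitWindow_succ_eq_append (n μ : ℕ) :
    digitWindow p n (μ + 1) = digitWindow p n μ ++ [n / p ^ μ % p] := by
  induction μ generalizing n with
  | zero => simp [digitWindow]
  | succ μ ih =>
    rw [digitWindow, ih, digitWindow, List.cons_append, Nat.div_div_eq_div_mul, ← pow_succ']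

theorem digitWindow_eq_iff (n : ℕ) (w : List ℕ) :
    digitWindow p n w.length = w ↔ ∀ (k : ℕ) (hk : k < w.length), n / p ^ k % p = w[k] := by
  induction w generalizing n with
  | nil => simp [digitWindow]
  | cons d w ih =>
    have h : digitWindow p n (d :: w).length = d :: w ↔
        n % p = d ∧ digitWindow p (n / p) w.length = w := by
      rw [List.length_cons, digitWindow, List.cons.injEq]
    rw [h, ih]
    constructor
    · rintro ⟨h0, h⟩ k hk
      cases k with
      | zero => simpa using h0
      | succ k =>
        rw [pow_succ', ← Nat.div_div_eq_div_mul, List.getElem_cons_succ]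
        exact h k (by simpa using hk)
    · intro h
      refine ⟨by simpa using h 0 (Nat.succ_pos _), fun k hk => ?_⟩
      have := h (k + 1) (by simpa using hk)
      rwa [pow_succ', ← Nat.div_div_eq_div_mul, List.getElem_cons_succ] at this

theorem blockCount_eq_ncard (w : List ℕ) (n : ℕ) :
    blockCount p w n = Set.ncard {i | digitWindow p (n / p ^ i) w.length = w} := by
  simp only [digitWindow_eq_iff, Nat.div_div_eq_div_mul, ← pow_add]
  rfl

theorem ofDigits_lt_pow {w : List ℕ} (hp : 1 < p) (hw : IsAdmissible p w) :
    Nat.ofDigits p w < p ^ w.length :=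
  Nat.ofDigits_lt_base_pow_length hp hw.digit_lt

theorem le_of_digitWindow_eq {w : List ℕ} (hw : IsAdmissible p w) {n : ℕ}
    (h : digitWindow p n w.length = w) : p ^ (w.length - 1) ≤ n := by
  obtain ⟨k, hk⟩ := Nat.exists_eq_add_of_le' hw.two_le_length
  have hk' : w.length = k + 1 + 1 := by omega
  rw [hk', digitWindow_succ_eq_append] at h
  rw [hk', Nat.add_sub_cancel]
  by_contra hlt
  refine hw.leftmost_ne ?_
  rw [← h, List.getLast?_concat, Nat.div_eq_of_lt (by omega), Nat.zero_mod]

theorem blockCount_eq_zero_of_lt {w : List ℕ} (hw : IsAdmissible p w) {n : ℕ}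
    (hn : n < p ^ (w.length - 1)) : blockCount p w n = 0 := by
  rw [blockCount_eq_ncard]
  convert Set.ncard_empty ℕ
  refine Set.eq_empty_of_forall_notMem fun i hi => ?_
  have := le_of_digitWindow_eq hw hi
  have := Nat.div_le_self n (p ^ i)
  omega

theorem blockCount_zero (hp : 0 < p) {w : List ℕ} (hw : IsAdmissible p w) :
    blockCount p w 0 = 0 :=
  blockCount_eq_zero_of_lt hw (pow_pos hp _)

/-- Split off the position $i=0$; the other positions are those of $\lfloor n/p\rfloor$, shifted by
one. -/
theorem blockCount_eq_add (hp : 1 < p) {w : List ℕ} (hw : IsAdmissible p w) (n : ℕ) :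
    blockCount p w n =
      blockCount p w (n / p) + if digitWindow p n w.length = w then 1 else 0 := by
  -- Finiteness, needed since `Set.ncard` is $0$ on infinite sets, comes from the nonzero leftmost
  -- digit.
  have hfin : ∀ n, {i | digitWindow p (n / p ^ i) w.length = w}.Finite := by
    intro n
    refine (Set.finite_Iio n).subset fun i hi => ?_
    have h1 := (Nat.le_div_iff_mul_le (by positivity)).1 (le_of_digitWindow_eq hw hi)
    have h2 : i < p ^ i := Nat.lt_pow_self hp
    have h3 : 0 < p ^ (w.length - 1) := by positivity
    exact h2.trans_le ((Nat.le_mul_of_pos_left _ h3).trans h1)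
  have hsucc : (Nat.succ '' {i | digitWindow p (n / p / p ^ i) w.length = w}).ncard =
      blockCount p w (n / p) := by
    rw [blockCount_eq_ncard, Set.ncard_image_of_injective _ Nat.succ_injective]
  have hmem : ∀ i, digitWindow p (n / p / p ^ i) w.length = w ↔
      digitWindow p (n / p ^ (i + 1)) w.length = w := by
    intro i
    rw [Nat.div_div_eq_div_mul, ← pow_succ']
  rw [← hsucc, blockCount_eq_ncard]
  split_ifs with h
  · rw [← Set.ncard_insert_of_notMem (a := 0) (by simp) ((hfin _).image _)]
    congr 1
    ext i
    cases i with
    | zero => simpa using h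
    | succ i => simp [hmem]
  · rw [add_zero]
    congr 1
    ext i
    cases i with
    | zero => simpa using h
    | succ i => simp [hmem]

/-- At least `w.length` zeros lie above `m`, so windows starting inside `m` see the same digits as
in `m` alone. -/
theorem blockCount_add_mul (hp : 1 < p) {w : List ℕ} (hw : IsAdmissible p w) {M : ℕ}
    (hM : w.length ≤ M) (N m n : ℕ) (hm : m < p ^ N) :
    blockCount p w (m + p ^ N * (p ^ M * n)) =
      blockCount p w m + blockCount p w (p ^ M * n) := by
  have hp0 : 0 < p := by omega
  induction N generalizing m with
  | zero =>
    obtain rfl : m = 0 := by simpa using hm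
    rw [pow_zero, one_mul, zero_add, blockCount_zero hp0 hw, zero_add]
  | succ N ih =>
    have h1 : (m + p ^ (N + 1) * (p ^ M * n)) / p = m / p + p ^ N * (p ^ M * n) := by
      rw [pow_succ', mul_assoc, Nat.add_mul_div_left _ _ hp0]
    have h2 : digitWindow p (m + p ^ (N + 1) * (p ^ M * n)) w.length =
        digitWindow p m w.length := by
      refine digitWindow_congr hp0 ?_
      obtain ⟨c, rfl⟩ := Nat.exists_eq_add_of_le hM
      rw [show p ^ (N + 1) * (p ^ (w.length + c) * n) =
        p ^ w.length * (p ^ (N + 1) * p ^ c * n) by ring, Nat.add_mul_mod_self_left]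
    rw [blockCount_eq_add hp hw, blockCount_eq_add hp hw m, h1, h2,
      ih _ (Nat.div_lt_of_lt_mul (by rwa [pow_succ'] at hm))]
    ring

/-- The new windows all have rightmost digit $p-1$, which is not admissible. -/
theorem blockCount_append_pred (hp : 1 < p) {w : List ℕ} (hw : IsAdmissible p w) (k v : ℕ) :
    blockCount p w (p ^ k * v + (p ^ k - 1)) = blockCount p w v := by
  have hp0 : 0 < p := by omega
  induction k with
  | zero => simp
  | succ k ih =>
    have hk : 0 < p ^ k := by positivity
    have h0 : p ^ (k + 1) * v + (p ^ (k + 1) - 1) =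
        (p - 1) + p * (p ^ k * v + (p ^ k - 1)) := by
      zify [hk, hp0, Nat.one_le_pow (k + 1) p hp0]
      ring
    have h1 : (p - 1 + p * (p ^ k * v + (p ^ k - 1))) / p = p ^ k * v + (p ^ k - 1) := by
      rw [Nat.add_mul_div_left _ _ hp0, Nat.div_eq_of_lt (by omega), zero_add]
    rw [blockCount_eq_add hp hw, h0, h1, ih, if_neg, add_zero]
    intro h
    obtain ⟨l, hl⟩ := Nat.exists_eq_add_of_le' hw.two_le_length
    refine hw.rightmost_ne ?_
    rw [← h, hl, digitWindow, List.head?_cons, Nat.add_mul_mod_self_left,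
      Nat.mod_eq_of_lt (by omega)]

/-- The number of blocks gained by appending zeros depends only on the lowest `w.length` digits; it
is written without subtraction. -/
theorem blockCount_mul_pow_add (hp : 1 < p) {w : List ℕ} (hw : IsAdmissible p w) {x y : ℕ}
    (hxy : x % p ^ w.length = y % p ^ w.length) (i : ℕ) :
    blockCount p w (p ^ i * x) + blockCount p w y =
      blockCount p w x + blockCount p w (p ^ i * y) := by
  have hp0 : 0 < p := by omega
  induction i with
  | zero => simp
  | succ i ih =>
    have h1 : ∀ z, p ^ (i + 1) * z / p = p ^ i * z := fun z => by
      rw [pow_succ', mul_assoc, Nat.mul_div_cancel_left _ hp0]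
    have h2 : digitWindow p (p ^ (i + 1) * x) w.length = digitWindow p (p ^ (i + 1) * y) w.length :=
      digitWindow_congr hp0 (Nat.ModEq.mul_left _ hxy)
    rw [blockCount_eq_add hp hw, blockCount_eq_add hp hw (p ^ (i + 1) * y), h1, h1, h2]
    omega

/-- Appending `M` digits `p - 1` and then `M` zeros shifts the block counts of short words by a
constant. -/
theorem blockCount_pad (hp : 1 < p) {w : List ℕ} (hw : IsAdmissible p w) {M : ℕ}
    (hM : w.length ≤ M) (v : ℕ) :
    blockCount p w (p ^ M * (p ^ M * v + (p ^ M - 1))) =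
      blockCount p w v + blockCount p w (p ^ M * (p ^ M - 1)) := by
  have h := blockCount_mul_pow_add hp hw (x := p ^ M * v + (p ^ M - 1)) (y := p ^ M - 1) (by
    obtain ⟨c, rfl⟩ := Nat.exists_eq_add_of_le hM
    rw [show p ^ (w.length + c) * v = p ^ w.length * (p ^ c * v) by ring, Nat.add_comm,
      Nat.add_mul_mod_self_left]) M
  have h0 : blockCount p w (p ^ M - 1) = 0 := by
    have := blockCount_append_pred hp hw M 0
    rwa [mul_zero, zero_add, blockCount_zero (by omega) hw] at this
  rw [h0, add_zero, blockCount_append_pred hp hw] at h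
  exact h

theorem blockCount_ofDigits_self (hp : 1 < p) {w : List ℕ} (hw : IsAdmissible p w) :
    blockCount p w (Nat.ofDigits p w) = 1 := by
  rw [blockCount_eq_add hp hw, if_pos (digitWindow_ofDigits hw.digit_lt),
    blockCount_eq_zero_of_lt hw]
  have := hw.two_le_length
  refine Nat.div_lt_of_lt_mul ?_
  rw [← pow_succ', Nat.sub_add_cancel (by omega)]
  exact ofDigits_lt_pow hp hw

theorem blockCount_ofDigits_of_ne (hp : 1 < p) {v w : List ℕ} (hv : IsAdmissible p v)
    (hw : IsAdmissible p w) (hlen : v.length ≤ w.length) (hne : v ≠ w) :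
    blockCount p w (Nat.ofDigits p v) = 0 := by
  have h2 := hw.two_le_length
  have hlt := ofDigits_lt_pow hp hv
  have hlt' : Nat.ofDigits p v < p ^ w.length := hlt.trans_le (Nat.pow_le_pow_right (by omega) hlen)
  rw [blockCount_eq_add hp hw, if_neg, add_zero, blockCount_eq_zero_of_lt hw]
  · refine Nat.div_lt_of_lt_mul ?_
    rwa [← pow_succ', Nat.sub_add_cancel (by omega)]
  · intro h
    have h3 := le_of_digitWindow_eq hw h
    have h4 : v.length = w.length := by
      by_contra hne'
      have := Nat.pow_le_pow_right (n := p) (by omega) (show v.length ≤ w.length - 1 by omega)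
      omega
    rw [← h4, digitWindow_ofDigits hv.digit_lt] at h
    exact hne h

/-- A polynomial in the block counts that vanishes for all `n` is zero. -/
theorem eq_zero_of_eval_blockCount {K : Type*} [Field K] [CharZero K] (hp : 1 < p)
    {Q : MvPolynomial (AdmissibleWord p) K}
    (hQ : ∀ n, MvPolynomial.eval (fun w => (blockCount p w.1 n : K)) Q = 0) : Q = 0 := by
  obtain ⟨F, q, rfl⟩ := MvPolynomial.exists_finset_rename Q
  have hp0 : 0 < p := by omega
  obtain ⟨M, hM⟩ : ∃ M, ∀ w : F, w.1.1.length ≤ M :=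
    ⟨F.sup fun w => w.1.length, fun w => Finset.le_sup (f := fun w => w.1.length) w.2⟩
  let s : ℕ → F → K := fun n w => (blockCount p w.1.1 n : K)
  -- The `M` trailing zeros prevent blocks from straddling the seam when two such numbers are
  -- concatenated.
  let S : AddSubmonoid (F → K) :=
    { carrier := {x | ∃ n, x = s (p ^ M * n)}
      add_mem' := by
        rintro _ _ ⟨m, rfl⟩ ⟨n, rfl⟩
        -- The exponent $p^Mm$ is a crude bound for the number of digits of $p^Mm$.
        refine ⟨m + p ^ (p ^ M * m) * n, ?_⟩
        funext w
        simp only [s, Pi.add_apply]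
        rw [mul_add, mul_left_comm, blockCount_add_mul hp w.1.2 (hM w) _ _ _ (Nat.lt_pow_self hp),
          Nat.cast_add]
      zero_mem' := ⟨0, by
        funext w
        simp [s, blockCount_zero hp0 w.1.2]⟩ }
  have hS : Submodule.span K (S : Set (F → K)) = ⊤ := by
    refine span_eq_top_of_unitriangular (fun w => w.1.1.length)
      (fun v => s (Nat.ofDigits p v.1.1)) (fun v => ?_) (fun v w hlen hne => ?_) _ fun v => ?_
    · simp [s, blockCount_ofDigits_self hp v.1.2]
    · simp only [s]
      rw [blockCount_ofDigits_of_ne hp v.1.2 w.1.2 hlen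
        (fun h => hne (Subtype.ext (Subtype.ext h))), Nat.cast_zero]
    -- The number represented by `v` need not be a multiple of $p^M$, but its count vector is a
    -- difference of two elements of `S`. The digits $p-1$ shield `v` from the zeros, so the
    -- correction does not depend on `v`.
    · have h : s (Nat.ofDigits p v.1.1) =
          s (p ^ M * (p ^ M * Nat.ofDigits p v.1.1 + (p ^ M - 1))) -
            s (p ^ M * (p ^ M - 1)) := by
        funext w
        simp only [s, Pi.sub_apply]
        rw [blockCount_pad hp w.1.2 (hM w), Nat.cast_add, add_sub_cancel_right]
      rw [h]
      exact Submodule.sub_mem _ (Submodule.subset_span ⟨_, rfl⟩) (Submodule.subset_span ⟨_, rfl⟩)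
  have hq : q = 0 := by
    refine MvPolynomial.eq_zero_of_eval_addSubmonoid S hS ?_
    rintro _ ⟨n, rfl⟩
    have := hQ (p ^ M * n)
    rwa [MvPolynomial.eval_rename] at this
  rw [hq, map_zero]

end Window

/-! ### The ratios $r_w$ and the product formula -/

section Ratio

open PowerSeries

variable {K : Type*} [Field K] [CharZero K] {p : ℕ}

variable (K p) in
/-- The normalized polynomial of `n` as a power series. -/
noncomputable def normRowSeries (n : ℕ) : K⟦X⟧ := (normRowPoly K p n : K⟦X⟧)

theorem constantCoeff_normRowSeries (n : ℕ) : constantCoeff (normRowSeries K p n) = 1 := by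
  rw [normRowSeries, Polynomial.constantCoeff_coe, normRowPoly_coeff_zero]

theorem normRowSeries_mul_inv (n : ℕ) : normRowSeries K p n * (normRowSeries K p n)⁻¹ = 1 :=
  PowerSeries.mul_inv_cancel _ (by rw [constantCoeff_normRowSeries]; exact one_ne_zero)

theorem ofDigits_rdropWhile (l : List ℕ) :
    Nat.ofDigits p (l.rdropWhile fun d => d == 0) = Nat.ofDigits p l := by
  induction l using List.reverseRecOn with
  | nil => simp
  | append_singleton l d ih =>
    rw [List.rdropWhile_concat]
    split_ifs with h
    · have : d = 0 := by simpa using h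
      rw [ih, this, Nat.ofDigits_append_zero]
    · rfl

theorem ofDigits_tail {l : List ℕ} (hl : ∀ d ∈ l, d < p) :
    Nat.ofDigits p l.tail = Nat.ofDigits p l / p := by
  cases l with
  | nil => simp
  | cons d l =>
    have hd : d < p := hl d (by simp)
    have hcons : Nat.ofDigits p (d :: l) = d + p * Nat.ofDigits p l := rfl
    rw [List.tail_cons, hcons, Nat.add_mul_div_left _ _ (by omega),
      Nat.div_eq_of_lt hd, zero_add]

omit [CharZero K] in
theorem wordRatio_digitWindow (hp : 0 < p) (n k : ℕ) :
    wordRatio K p (digitWindow p n (k + 2)) =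
      normRowSeries K p (n % p ^ (k + 2)) * normRowSeries K p (n / p % p ^ k) *
        (normRowSeries K p (n / p % p ^ (k + 1)) * normRowSeries K p (n % p ^ (k + 1)))⁻¹ := by
  have hL : Nat.ofDigits p (leftTrunc (digitWindow p n (k + 2))) = n % p ^ (k + 1) := by
    rw [leftTrunc, digitWindow_succ_eq_append, List.dropLast_concat, ofDigits_rdropWhile,
      ofDigits_digitWindow]
  have hLlt : ∀ d ∈ leftTrunc (digitWindow p n (k + 2)), d < p := fun d hd =>
    digitWindow_lt hp n (k + 2) d
      (List.dropLast_subset _ ((List.rdropWhile_prefix _ _).subset hd))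
  have hLR : Nat.ofDigits p (rightTrunc (leftTrunc (digitWindow p n (k + 2)))) =
      n / p % p ^ k := by
    rw [rightTrunc, ofDigits_tail hLlt, hL, pow_succ', Nat.mod_mul,
      Nat.add_mul_div_left _ _ hp, Nat.div_eq_of_lt (Nat.mod_lt _ hp), zero_add]
  have hR : Nat.ofDigits p (rightTrunc (digitWindow p n (k + 2))) = n / p % p ^ (k + 1) := by
    rw [rightTrunc, digitWindow, List.tail_cons, ofDigits_digitWindow]
  rw [wordRatio, wordSeries, wordSeries, wordSeries, wordSeries, hL, hLR, hR,
    ofDigits_digitWindow]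
  rfl

/-- Divide `exists_cross_eq` by the denominator of the ratio. Inadmissible windows are included,
since they occur in the telescoping product; there the ratio is $1$. -/
theorem exists_wordRatio_sub_one_eq (hp : p.Prime) (n k : ℕ) :
    ∃ (c : K) (u : K⟦X⟧), (n / p ^ (k + 1) % p = 0 → c = 0) ∧ (n % p = p - 1 → c = 0) ∧
      wordRatio K p (digitWindow p n (k + 2)) - 1 = C c * X ^ (k + 1) * u := by
  obtain ⟨c, hca, hcb, h⟩ := exists_cross_eq K hp (a := n / p ^ (k + 1) % p) (b := n % p)
    (Nat.mod_lt _ hp.pos) (Nat.mod_lt _ hp.pos) k (n / p % p ^ k)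
    (Nat.mod_lt _ (pow_pos hp.pos _))
  have e1 : n / p % p ^ k + p ^ k * (n / p ^ (k + 1) % p) = n / p % p ^ (k + 1) := by
    rw [pow_succ p k, Nat.mod_mul, mul_comm (p ^ k) p, ← Nat.div_div_eq_div_mul]
  have e2 : p * (n / p % p ^ k) + n % p = n % p ^ (k + 1) := by
    rw [pow_succ' p k, Nat.mod_mul, Nat.add_comm]
  have e3 : p * (n / p % p ^ (k + 1)) + n % p = n % p ^ (k + 2) := by
    rw [pow_succ' p (k + 1), Nat.mod_mul, Nat.add_comm]
  rw [e1, e2, e3] at h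
  have h' := congrArg (fun q : Polynomial K => (q : K⟦X⟧)) h
  simp only [Polynomial.coe_sub, Polynomial.coe_mul, Polynomial.coe_C, Polynomial.coe_pow,
    Polynomial.coe_X] at h'
  refine ⟨c, (normRowSeries K p (n / p % p ^ (k + 1)) * normRowSeries K p (n % p ^ (k + 1)))⁻¹,
    hca, hcb, ?_⟩
  have hinv := PowerSeries.mul_inv_cancel
    (normRowSeries K p (n / p % p ^ (k + 1)) * normRowSeries K p (n % p ^ (k + 1)))
    (by rw [map_mul, constantCoeff_normRowSeries, constantCoeff_normRowSeries]; simp)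
  rw [wordRatio_digitWindow hp.pos, ← h']
  simp only [normRowSeries] at hinv ⊢
  linear_combination hinv

theorem X_pow_dvd_wordRatio_sub_one (hp : p.Prime) {w : List ℕ} (hw : IsAdmissible p w) :
    (X : K⟦X⟧) ^ (w.length - 1) ∣ wordRatio K p w - 1 := by
  obtain ⟨k, hk⟩ := Nat.exists_eq_add_of_le' hw.two_le_length
  obtain ⟨c, u, -, -, h⟩ := exists_wordRatio_sub_one_eq (K := K) hp (Nat.ofDigits p w) k
  rw [← hk, digitWindow_ofDigits hw.digit_lt] at h
  rw [h, hk]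
  exact (dvd_mul_left _ _).mul_right _

theorem constantCoeff_wordRatio (hp : p.Prime) {w : List ℕ} (hw : IsAdmissible p w) :
    constantCoeff (wordRatio K p w) = 1 := by
  have h := (dvd_pow_self (X : K⟦X⟧) (by have := hw.two_le_length; omega)).trans
    (X_pow_dvd_wordRatio_sub_one (K := K) hp hw)
  rw [X_dvd_iff, map_sub, map_one, sub_eq_zero] at h
  exact h

theorem isAdmissible_of_wordRatio_ne_one (hp : p.Prime) {n k : ℕ}
    (h : wordRatio K p (digitWindow p n (k + 2)) ≠ 1) :
    IsAdmissible p (digitWindow p n (k + 2)) := by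
  obtain ⟨c, u, hca, hcb, hc⟩ := exists_wordRatio_sub_one_eq (K := K) hp n k
  have hc0 : c ≠ 0 := by
    rintro rfl
    rw [map_zero, zero_mul, zero_mul, sub_eq_zero] at hc
    exact h hc
  refine ⟨digitWindow_lt hp.pos n _, by simp, ?_, ?_⟩
  · rw [digitWindow_succ_eq_append, List.getLast?_concat]
    exact fun h0 => hc0 (hca (Option.some.inj h0))
  · rw [digitWindow, List.head?_cons]
    exact fun h0 => hc0 (hcb (Option.some.inj h0))

/-- Lengthening the window by one digit cancels the previous numerator and denominator; the start is
trivial because $\overline T$ is $1$ at single digits. -/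
theorem prod_wordRatio_digitWindow (hp : p.Prime) (n L : ℕ) :
    ∏ k ∈ Finset.range L, wordRatio K p (digitWindow p n (k + 2)) =
      normRowSeries K p (n % p ^ (L + 1)) * (normRowSeries K p (n / p % p ^ L))⁻¹ := by
  induction L with
  | zero =>
    have h1 : normRowSeries K p (n % p) = 1 := by
      rw [normRowSeries, normRowPoly_of_lt K hp (Nat.mod_lt _ hp.pos), Polynomial.coe_one]
    have h2 : normRowSeries K p 0 = 1 := by
      rw [normRowSeries, normRowPoly_zero, Polynomial.coe_one]
    simp [Nat.mod_one, h1, h2]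
  | succ L ih =>
    rw [Finset.prod_range_succ, ih, wordRatio_digitWindow hp.pos, PowerSeries.mul_inv_rev]
    have h1 := normRowSeries_mul_inv (K := K) (p := p) (n % p ^ (L + 1))
    have h2 := normRowSeries_mul_inv (K := K) (p := p) (n / p % p ^ L)
    linear_combination (normRowSeries K p (n % p ^ (L + 2)) *
      (normRowSeries K p (n / p % p ^ (L + 1)))⁻¹) *
      (h1 + normRowSeries K p (n % p ^ (L + 1)) * (normRowSeries K p (n % p ^ (L + 1)))⁻¹ * h2)

theorem finite_admissibleWord_length_le (hp : 1 < p) (L : ℕ) :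
    {w : AdmissibleWord p | w.1.length ≤ L}.Finite := by
  have hfin : (Set.image2 (digitWindow p) (Set.Iio (p ^ L)) (Set.Iic L)).Finite :=
    (Set.finite_Iio _).image2 _ (Set.finite_Iic _)
  refine (hfin.preimage Subtype.val_injective.injOn).subset fun w hw => ?_
  refine ⟨Nat.ofDigits p w.1, ?_, w.1.length, hw, digitWindow_ofDigits w.2.digit_lt⟩
  exact (ofDigits_lt_pow hp w.2).trans_le (Nat.pow_le_pow_right (by omega) hw)

/-- The admissible words of length at most `L`. -/
noncomputable def shortWords (hp : 1 < p) (L : ℕ) : Finset (AdmissibleWord p) :=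
  (finite_admissibleWord_length_le hp L).toFinset

theorem mem_shortWords (hp : 1 < p) {L : ℕ} {w : AdmissibleWord p} :
    w ∈ shortWords hp L ↔ w.1.length ≤ L := by
  simp [shortWords]

/-- Windows at position $0$ are distinguished by their lengths, and the inadmissible ones contribute
the factor $1$. -/
theorem prod_shortWords_digitWindow (hp : p.Prime) (n L : ℕ) :
    ∏ w ∈ shortWords hp.one_lt (L + 1),
      wordRatio K p w.1 ^ (if digitWindow p n w.1.length = w.1 then 1 else 0) =
      ∏ k ∈ Finset.range L, wordRatio K p (digitWindow p n (k + 2)) := by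
  symm
  refine Finset.prod_bij_ne_one
    (fun k _ hk => ⟨digitWindow p n (k + 2), isAdmissible_of_wordRatio_ne_one hp hk⟩) ?_ ?_ ?_ ?_
  · intro k hk _
    rw [mem_shortWords, length_digitWindow]
    have := Finset.mem_range.1 hk
    omega
  · intro k _ _ l _ _ h
    have := congrArg (fun w : AdmissibleWord p => w.1.length) h
    simpa using this
  · intro w hw hne
    have hwin : digitWindow p n w.1.length = w.1 := by
      by_contra h0
      rw [if_neg h0, pow_zero] at hne
      exact hne rfl
    rw [if_pos hwin, pow_one] at hne
    obtain ⟨k, hk⟩ := Nat.exists_eq_add_of_le' w.2.two_le_length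
    rw [mem_shortWords] at hw
    rw [hk] at hwin
    exact ⟨k, Finset.mem_range.2 (by omega), by rwa [hwin], Subtype.ext hwin⟩
  · intro k _ _
    simp

/-- The factorization of the normalized polynomials by block occurrences. -/
theorem normRowSeries_eq_prod (hp : p.Prime) (L : ℕ) {n : ℕ} (hn : n < p ^ (L + 1)) :
    normRowSeries K p n =
      ∏ w ∈ shortWords hp.one_lt (L + 1), wordRatio K p w.1 ^ blockCount p w.1 n := by
  induction n using Nat.strong_induction_on with
  | _ n ih =>
    rcases Nat.eq_zero_or_pos n with rfl | hpos
    · rw [Finset.prod_eq_one fun w _ => by rw [blockCount_zero hp.pos w.2, pow_zero],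
        normRowSeries, normRowPoly_zero, Polynomial.coe_one]
    · have hlt : n / p < n := Nat.div_lt_self hpos hp.one_lt
      rw [Finset.prod_congr rfl fun w _ => by
          rw [blockCount_eq_add hp.one_lt w.2 n, pow_add],
        Finset.prod_mul_distrib, ← ih _ hlt (hlt.trans hn), prod_shortWords_digitWindow hp,
        prod_wordRatio_digitWindow hp, Nat.mod_eq_of_lt hn,
        Nat.mod_eq_of_lt (Nat.div_lt_of_lt_mul (by rwa [pow_succ'] at hn)), mul_left_comm,
        normRowSeries_mul_inv, mul_one]

/-- Words longer than $j+1$ have ratio $1$ modulo $X^{j+1}$, so they can be dropped from the full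
factorization. -/
theorem coeff_prod_shortWords (hp : p.Prime) (j n : ℕ) :
    coeff j (∏ w ∈ shortWords hp.one_lt (j + 1), wordRatio K p w.1 ^ blockCount p w.1 n) =
      (rowCount p j n : K) / rowCount p 0 n := by
  have hn : n < p ^ (j + n + 1) :=
    (Nat.lt_pow_self hp.one_lt).trans_le (Nat.pow_le_pow_right hp.pos (by omega))
  rw [← normRowPoly_coeff, ← Polynomial.coeff_coe, ← normRowSeries,
    normRowSeries_eq_prod hp (j + n) hn, ← sub_eq_zero, ← map_sub]
  refine X_pow_dvd_iff.1 ?_ j (Nat.lt_succ_self j)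
  rw [← Ideal.mem_span_singleton, ← Ideal.Quotient.eq, map_prod, map_prod]
  refine Finset.prod_subset (fun w hw => ?_) fun w _ hw => ?_
  · rw [mem_shortWords] at hw ⊢
    omega
  · rw [mem_shortWords, not_le] at hw
    have h1 : Ideal.Quotient.mk (Ideal.span {(X : K⟦X⟧) ^ (j + 1)}) (wordRatio K p w.1) = 1 := by
      rw [← map_one (Ideal.Quotient.mk _), Ideal.Quotient.eq, Ideal.mem_span_singleton]
      exact (pow_dvd_pow X (by omega)).trans (X_pow_dvd_wordRatio_sub_one hp w.2)
    rw [map_pow, h1, one_pow]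

theorem isAdmissible_zero_one (hp : p.Prime) : IsAdmissible p [0, 1] := by
  have := hp.two_le
  refine ⟨?_, by simp, by simp, ?_⟩
  · simp only [List.mem_cons, List.not_mem_nil, or_false]
    omega
  · simp only [List.head?_cons, ne_eq, Option.some.injEq]
    omega

/-- For the word $10$ the ratio is just $\overline T_p=1+\frac{p-1}2x$. -/
theorem coeff_one_wordRatio_zero_one (hp : p.Prime) :
    coeff 1 (wordRatio K p [0, 1]) = ((p : K) - 1) / 2 := by
  have hw : digitWindow p p 2 = [0, 1] := by
    simp [digitWindow, Nat.div_self hp.pos, Nat.mod_eq_of_lt hp.one_lt]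
  have h := wordRatio_digitWindow (K := K) hp.pos p 0
  have h1 : p % p ^ (0 + 2) = p * 1 + 0 := by
    rw [Nat.mod_eq_of_lt (by
      rw [zero_add, pow_two]
      exact (Nat.lt_mul_iff_one_lt_left hp.pos).2 hp.one_lt), mul_one, add_zero]
  rw [zero_add, hw, ← zero_add 2, h1, Nat.div_self hp.pos, zero_add, pow_zero, pow_one, Nat.mod_one,
    Nat.mod_self, Nat.mod_eq_of_lt hp.one_lt] at h
  have s0 : normRowSeries K p 0 = 1 := by rw [normRowSeries, normRowPoly_zero, Polynomial.coe_one]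
  have s1 : normRowSeries K p 1 = 1 := by
    rw [normRowSeries, normRowPoly_of_lt K hp hp.one_lt, Polynomial.coe_one]
  rw [s0, s1, normRowSeries, normRowPoly_mul_add K hp 1 hp.pos, normRowPoly_of_lt K hp hp.one_lt,
    normCompanionPoly_of_lt K hp hp.one_lt, mul_one, mul_one, inv_one, mul_one] at h
  rw [h, Polynomial.coeff_coe, Polynomial.coeff_add, Polynomial.coeff_C_mul,
    Polynomial.coeff_X_mul, Polynomial.coeff_C_zero, Polynomial.coeff_one, if_neg one_ne_zero]
  push_cast
  ring

end Ratio

/-! ### Assembly of the theorem -/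

theorem expMonomial_sum_single {σ K ι : Type*} [Field K] [Fintype ι] (L : σ → PowerSeries K)
    {w : ι → σ} (hw : Function.Injective w) (k : ι → ℕ) :
    expMonomial L (∑ i, Finsupp.single (w i) (k i)) =
      ∏ i, PowerSeries.C (((k i).factorial : K)⁻¹) * L (w i) ^ k i := by
  classical
  have hval : ∀ i, (∑ i, Finsupp.single (w i) (k i)) (w i) = k i := by
    intro i
    rw [Finsupp.finsetSum_apply, Finset.sum_eq_single i]
    · simp
    · intro b _ hb
      rw [Finsupp.single_eq_of_ne (hw.ne hb).symm]
    · simp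
  rw [expMonomial, Finsupp.prod_of_support_subset (s := Finset.univ.image w) _ ?_ _ (by simp),
    Finset.prod_image hw.injOn]
  · exact Finset.prod_congr rfl fun i _ => by rw [hval]
  · refine Finsupp.support_finsetSum.trans fun x hx => ?_
    simp only [Finset.mem_biUnion, Finset.mem_univ, true_and] at hx
    obtain ⟨i, hi⟩ := hx
    rw [Finset.mem_singleton.1 (Finsupp.support_single_subset hi)]
    exact Finset.mem_image_of_mem w (Finset.mem_univ i)

theorem theorem1 {K : Type*} [Field K] [CharZero K] (p : ℕ) (hp : p.Prime) :
    ∃ P : ℕ → MvPolynomial (AdmissibleWord p) K,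
      (∀ j : ℕ,
        Represents p j (P j) ∧
        (∀ Q : MvPolynomial (AdmissibleWord p) K, Represents p j Q → Q = P j) ∧
        (P j).totalDegree = j ∧
        (∀ w ∈ (P j).vars, w.1.length ≤ j + 1)) ∧
      (∀ w : AdmissibleWord p, PowerSeries.constantCoeff (wordRatio K p w.1) = 1) ∧
      ∀ (l : ℕ) (w : Fin l → AdmissibleWord p) (k : Fin l → ℕ),
        Function.Injective w → (∀ i, 0 < k i) →
          PowerSeries.mk (fun j : ℕ =>
              MvPolynomial.coeff (∑ i, Finsupp.single (w i) (k i)) (P j)) =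
            ∏ i, PowerSeries.C (((k i).factorial : K)⁻¹) *
              PowerSeries.logOf (wordRatio K p (w i).1) ^ k i := by
  have hr : ∀ w : AdmissibleWord p, PowerSeries.constantCoeff (wordRatio K p w.1) = 1 :=
    fun w => constantCoeff_wordRatio hp w.2
  have hd : ∀ w : AdmissibleWord p, 1 ≤ w.1.length - 1 := fun w => by
    have := w.2.two_le_length
    omega
  have hL : ∀ w : AdmissibleWord p, (PowerSeries.X : PowerSeries K) ^ (w.1.length - 1) ∣
      PowerSeries.logOf (wordRatio K p w.1) := fun w =>
    PowerSeries.X_pow_dvd_logOf (hd w) (X_pow_dvd_wordRatio_sub_one hp w.2)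
  have hF : ∀ (j : ℕ) (w : AdmissibleWord p), w.1.length - 1 ≤ j →
      w ∈ shortWords hp.one_lt (j + 1) := fun j w hw => by
    rw [mem_shortWords]
    omega
  have hrep : ∀ j, Represents p j (expCoeff (fun w : AdmissibleWord p =>
      PowerSeries.logOf (wordRatio K p w.1)) (shortWords hp.one_lt (j + 1)) j) := fun j n => by
    rw [eval_expCoeff_logOf hr, coeff_prod_shortWords hp]
  refine ⟨fun j => expCoeff (fun w => PowerSeries.logOf (wordRatio K p w.1))
    (shortWords hp.one_lt (j + 1)) j, fun j => ⟨hrep j, fun Q hQ => ?_, ?_, fun w hw => ?_⟩, hr,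
    fun l w k hw _ => ?_⟩
  · rw [← sub_eq_zero]
    refine eq_zero_of_eval_blockCount hp.one_lt fun n => ?_
    rw [map_sub, hQ n, hrep j n, sub_self]
  -- The word $10$ is admissible for every `p`, and its logarithm has nonzero linear coefficient
  -- $(p-1)/2$.
  · refine totalDegree_expCoeff hd hL (hF j) (w := ⟨[0, 1], isAdmissible_zero_one hp⟩) ?_
    rw [PowerSeries.coeff_one_logOf (constantCoeff_wordRatio hp (isAdmissible_zero_one hp)),
      coeff_one_wordRatio_zero_one hp]
    refine div_ne_zero (sub_ne_zero.2 ?_) two_ne_zero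
    exact_mod_cast hp.one_lt.ne'
  · have := le_of_mem_vars_expCoeff hd hL (hF j) hw
    omega
  · ext j
    rw [PowerSeries.coeff_mk, coeff_expCoeff hd hL (hF j), expMonomial_sum_single _ hw]
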